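/- A generalised Muller game is given by a finite directed graph $(V,E)$ in which every vertex has an outgoing edge, a starting vertex $v_0\in V$, a set $A$ of players, a partition $(V_a)_{a\in A}$ of $V$ (the blocks may be empty; player $a$ moves at the vertices of $V_a$), a set $O$ of outcomes, a map assigning an outcome to each set of vertices, and for each player $a\in A$ a binary relation $\prec_a$ on $O$. The outcome of an infinite path from $v_0$ is the one assigned to the set of vertices that the path visits infinitely often; below, $O$ is restricted to the outcomes of infinite paths from $v_0$ (the realizable outcomes). A strategy of player $a$ chooses an outgoing edge at each finite path from $v_0$ ending in $V_a$. A strategy profile (one strategy per player) induces an infinite path from $v_0$ and hence an outcome. It is a Nash equilibrium if no player $a$, by replacing her own strategy with any other strategy, obtains an outcome that is $\succ_a$ the one induced by the profile. A strategy $s$ of player $a$ is finite-memory if for some $m\in\mathbb N$ there is a function $f=(f_1,f_2): V\times\{0,1\}^m\to V\times\{0,1\}^m$ such that, with $M(v_0)=0^m$ and $M(hv)=f_2(v,M(h))$, one has $s(hv)=f_1(v,M(hv))$ for all finite paths $hv$ from $v_0$ with $v\in V_a$ (including $hv=v_0$ if $v_0\in V_a$). A profile is finite-memory if all its strategies are.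 A Nash equilibrium with outcome $o$ is Pareto-optimal if there is no realizable outcome $q\neq o$ such that $o\prec_a q$ for some player $a$ and $q\prec_b o$ for no player $b$. (1) If every $\prec_a$ is acyclic (for instance a strict weak order, or any strict partial order), then the game has a finite-memory Nash equilibrium. (2) If every $\prec_a$ is a strict linear order, and there are no players $a,b\in A$ and outcomes $x,y,z\in O$ with $z\prec_a y\prec_a x$ and $x\prec_b z\prec_b y$, then the game has a Pareto-optimal finite-memory Nash equilibrium. -/

import Mathlib

/-- A generalised Muller game: a directed graph in which every vertex has an outgoing edge, a
starting vertex, a partition of the vertices among the players (given by the `owner` map), a map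
giving an outcome to each possible set of vertices visited infinitely often, and for each player
a preference relation on outcomes (`pref a x y` is `x ≺_a y`). Taking `O = Set V` and
`outcome = id` gives preferences stated directly on sets of vertices. -/
structure MullerGame (V A O : Type*) where
  E : V → V → Prop
  exists_succ : ∀ v, ∃ w, E v w
  start : V
  owner : V → A
  outcome : Set V → O
  pref : A → O → O → Prop

namespace MullerGame

variable {V A O : Type*} (G : MullerGame V A O)

/-- Finite histories: the nonempty finite paths from the starting vertex, in chronological
order. -/
def History : Type _ :=
  {h : List V // h.head? = some G.start ∧ h.IsChain G.E}

theorem History.ne_nil {G : MullerGame V A O} (h : G.History) : h.1 ≠ [] := by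
  intro h0
  have := h.2.1
  simp [h0] at this

/-- The current vertex of a history. -/
def History.last {G : MullerGame V A O} (h : G.History) : V :=
  h.1.getLast h.ne_nil

/-- The history consisting of the starting vertex only. -/
def initial : G.History :=
  ⟨[G.start], by simp⟩

/-- Extension of a history along an edge. -/
def History.extend {G : MullerGame V A O} (h : G.History) (w : V) (hw : G.E h.last w) :
    G.History :=
  ⟨h.1 ++ [w], by
    refine ⟨?_, ?_⟩
    · rw [List.head?_append, h.2.1]; rfl
    · rw [List.isChain_append]
      refine ⟨h.2.2, by simp, ?_⟩
      intro x hx y hy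
      rw [List.getLast?_eq_some_getLast h.ne_nil] at hx
      simp only [Option.mem_def, Option.some.injEq, List.head?_cons] at hx hy
      subst hx hy
      exact hw⟩

theorem History.last_extend {G : MullerGame V A O} (h : G.History) (w : V)
    (hw : G.E h.last w) : (h.extend w hw).last = w := by
  simp [History.extend, History.last]

/-- The histories at which it is the turn of player `a`. -/
def HistoryOf (a : A) : Type _ :=
  {h : G.History // G.owner h.last = a}

/-- A strategy of player `a` picks an outgoing edge at each history ending in a vertex of `a`. -/
def Strategy (a : A) : Type _ :=
  {s : G.HistoryOf a → V // ∀ h : G.HistoryOf a, G.E h.1.last (s h)}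

/-- Strategy profiles. -/
def Profile : Type _ :=
  ∀ a : A, G.Strategy a

/-- The history reached after `n` moves under a strategy profile. -/
def historyAt (σ : G.Profile) : ℕ → G.History
  | 0 => G.initial
  | n + 1 =>
    let h := historyAt σ n
    h.extend ((σ (G.owner h.last)).1 ⟨h, rfl⟩) ((σ (G.owner h.last)).2 ⟨h, rfl⟩)

/-- The run induced by a strategy profile. -/
def inducedRun (σ : G.Profile) (n : ℕ) : V :=
  (G.historyAt σ n).last

/-- The infinite paths in the graph from the starting vertex. -/
def IsRun (p : ℕ → V) : Prop :=
  p 0 = G.start ∧ ∀ n, G.E (p n) (p (n + 1))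

theorem isRun_inducedRun (σ : G.Profile) : G.IsRun (G.inducedRun σ) := by
  refine ⟨rfl, fun n => ?_⟩
  have h : G.inducedRun σ (n + 1) =
      (σ (G.owner (G.historyAt σ n).last)).1 ⟨G.historyAt σ n, rfl⟩ :=
    History.last_extend _ _ ((σ (G.owner (G.historyAt σ n).last)).2 ⟨G.historyAt σ n, rfl⟩)
  rw [h]
  exact (σ (G.owner (G.historyAt σ n).last)).2 ⟨G.historyAt σ n, rfl⟩

/-- The set of vertices visited infinitely often. -/
def infSet (p : ℕ → V) : Set V :=
  {v | ∃ᶠ n in Filter.atTop, p n = v}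

/-- The outcomes that occur in the game: those assigned to some run. -/
def RealizableOutcome : Type _ :=
  {o : O // ∃ p, G.IsRun p ∧ G.outcome (infSet p) = o}

/-- The preference of a player on the outcomes that occur in the game. -/
def Prefers (a : A) (x y : G.RealizableOutcome) : Prop :=
  G.pref a x.1 y.1

/-- The outcome induced by a strategy profile. -/
def inducedOutcome (σ : G.Profile) : G.RealizableOutcome :=
  ⟨G.outcome (infSet (G.inducedRun σ)), G.inducedRun σ, G.isRun_inducedRun σ, rfl⟩

open Classical in
/-- Nash equilibrium: no player prefers the outcome obtained by changing only her own strategy,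
to any strategy whatsoever. -/
def IsNash (σ : G.Profile) : Prop :=
  ∀ (a : A) (s : G.Strategy a),
    ¬ G.Prefers a (G.inducedOutcome σ) (G.inducedOutcome (Function.update σ a s))

/-- Memory content, of `m` bits, after a history: it is `0^m` at the starting vertex, and is
updated upon reaching each further vertex. -/
def memory {m : ℕ} (f : V × (Fin m → Bool) → V × (Fin m → Bool)) (h : G.History) :
    Fin m → Bool :=
  h.1.tail.foldl (fun M v => (f (v, M)).2) (fun _ => false)

/-- A finite-memory strategy: one that is implemented by some
`f : V × {0,1}^m → V × {0,1}^m`, whose first component is the choice at the current vertex with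
the current memory content, and whose second component is the memory update. -/
def Strategy.IsFiniteMemory {G : MullerGame V A O} {a : A} (s : G.Strategy a) : Prop :=
  ∃ (m : ℕ) (f : V × (Fin m → Bool) → V × (Fin m → Bool)),
    ∀ h : G.HistoryOf a, s.1 h = (f (h.1.last, G.memory f h.1)).1

/-- A profile all of whose strategies are finite-memory. -/
def IsFiniteMemory (σ : G.Profile) : Prop :=
  ∀ a : A, (σ a).IsFiniteMemory

/-- Pareto-optimality: no other realizable outcome is preferred by some player while no player
has the opposite preference. -/
def IsParetoOptimal (o : G.RealizableOutcome) : Prop :=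
  ¬ ∃ q : G.RealizableOutcome, q ≠ o ∧ (∃ a, G.Prefers a o q) ∧ ∀ b, ¬ G.Prefers b q o

/-- The preferences have no cycles `x₁ ≺_a x₂ ≺_a ⋯ ≺_a x₁`. Strict partial orders, in particular
strict weak orders and strict linear orders, have this property. -/
def AcyclicPreferences : Prop :=
  ∀ (a : A) (x : G.RealizableOutcome), ¬ Relation.TransGen (G.Prefers a) x x

/-- The preferences are strict linear orders. -/
def LinearPreferences : Prop :=
  ∀ a : A, IsStrictTotalOrder G.RealizableOutcome (G.Prefers a)

/-- The pattern `z ≺_a y ≺_a x`, `x ≺_b z ≺_b y` does not occur. -/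
def AvoidsPattern : Prop :=
  ∀ (a b : A) (x y z : G.RealizableOutcome),
    ¬ ((G.Prefers a z y ∧ G.Prefers a y x) ∧ (G.Prefers b x z ∧ G.Prefers b z y))

end MullerGame

namespace MullerGame

universe u

/-! ### Sets of vertices visited infinitely often -/

/-! Each preference is replaced by an integer payoff that increases along it (`rank`), so that each
player has a value at each vertex: the best payoff she can guarantee from there. Muller games on
finite graphs are determined with finite memory (`wins_or_opponent_wins`), so the other players can
hold her down to her value. Conversely, strategies guaranteeing the values of all players can be
followed at once, because every vertex has one owner; switching to a better guarantee whenever a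
value rises gives a run that pays everyone at least each of her values met on it (`exists_values`).
Threats turn this run into an equilibrium: whoever leaves it is held down to her value at the vertex
where she left, hence to at most what the run pays her (`exists_finiteMemory_nash`). Memory stays
finite because the run can be replaced by a lasso. This gives (1).

For (2), the forbidden pattern says that two players order three outcomes by distinct cyclic
rotations of each other. Without it, everybody ranks the Pareto-optimal outcomes above the others,
and any two players agree or are opposite on the Pareto-optimal ones. This makes two camps, with
payoff 0 for the outcomes that are not Pareto-optimal. Along a run with Pareto-optimal outcome,
either some value is positive, and continuing from the first such vertex along a run that attains
the values gives a positive payoff and so Pareto-optimality; or all values are 0, and the run itself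
serves. -/

theorem mem_infSet {V : Type*} {p : ℕ → V} {v : V} :
    v ∈ infSet p ↔ ∀ N, ∃ n, N ≤ n ∧ p n = v :=
  Filter.frequently_atTop

theorem infSet_shift {V : Type*} (p : ℕ → V) (k : ℕ) : infSet (fun n => p (n + k)) = infSet p := by
  ext v
  rw [mem_infSet, mem_infSet]
  constructor
  · intro h N
    obtain ⟨n, hn, hv⟩ := h N
    exact ⟨n + k, by omega, hv⟩
  · intro h N
    obtain ⟨n, hn, hv⟩ := h (N + k)
    exact ⟨n - k, by omega, by rwa [Nat.sub_add_cancel (by omega)]⟩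

theorem infSet_eq_of_eventually_eq {V : Type*} {p q : ℕ → V} (k l : ℕ)
    (h : ∀ n, p (n + k) = q (n + l)) : infSet p = infSet q := by
  rw [← infSet_shift p k, ← infSet_shift q l]
  exact congrArg infSet (funext h)

/-! ### Strategy graphs -/

/-- A finite-memory strategy, in the form of a graph `T` over the vertices of the subarena `U`,
for the player who owns the vertices of `P`: at the vertices of `P` some continuation is chosen,
at the other ones every continuation is provided for, and every infinite path is won. -/
structure IsStrategyGraph {V : Type*} (E : V → V → Prop) (P : Set V) (W : Set (Set V)) (U : Set V)
    {Q : Type*} (π : Q → V) (T : Q → Q → Prop) : Prop where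
  mem : ∀ q, π q ∈ U
  edge : ∀ q q', T q q' → E (π q) (π q')
  own : ∀ q, π q ∈ P → ∃ q', T q q'
  opp : ∀ q, π q ∉ P → ∀ w ∈ U, E (π q) w → ∃ q', T q q' ∧ π q' = w
  win : ∀ x : ℕ → Q, (∀ n, T (x n) (x (n + 1))) → infSet (fun n => π (x n)) ∈ W

/-- The owner of `P` has a finite-memory winning strategy from `v` in the subarena `U`. -/
def Wins {V : Type u} (E : V → V → Prop) (P : Set V) (W : Set (Set V)) (U : Set V) (v : V) :
    Prop :=
  ∃ (Q : Type u) (_ : Finite Q) (π : Q → V) (T : Q → Q → Prop),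
    IsStrategyGraph E P W U π T ∧ ∃ q, π q = v

/-- The disjoint union of a family of relations. -/
inductive SigmaRel {ι : Type*} {Q : ι → Type*} (T : ∀ i, Q i → Q i → Prop) :
    (Σ i, Q i) → (Σ i, Q i) → Prop
  | mk (i : ι) (q q' : Q i) : T i q q' → SigmaRel T ⟨i, q⟩ ⟨i, q'⟩

/-- No move changes the summand, so the index is constant along a path. -/
theorem SigmaRel.exists_path {ι : Type*} {Q : ι → Type*} {T : ∀ i, Q i → Q i → Prop}
    {x : ℕ → Σ i, Q i} (h : ∀ n, SigmaRel T (x n) (x (n + 1))) :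
    ∃ (i : ι) (y : ℕ → Q i), (∀ n, x n = ⟨i, y n⟩) ∧ ∀ n, T i (y n) (y (n + 1)) := by
  have hx : ∀ n, ∃ q : Q (x 0).1, x n = ⟨(x 0).1, q⟩ := by
    intro n
    induction n with
    | zero => exact ⟨(x 0).2, rfl⟩
    | succ n ih =>
      obtain ⟨q, hq⟩ := ih
      have := h n
      rw [hq] at this
      generalize x (n + 1) = z at this ⊢
      cases this with
      | mk _ _ q' _ => exact ⟨q', rfl⟩
  choose y hy using hx
  refine ⟨_, y, hy, fun n => ?_⟩
  have := h n
  rw [hy n, hy (n + 1)] at this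
  cases this with
  | mk _ _ _ hT => exact hT

section Wins

variable {V : Type u} {E : V → V → Prop} {P P' : Set V} {W W' : Set (Set V)} {U U' : Set V} {v : V}

theorem Wins.mem (h : Wins E P W U v) : v ∈ U := by
  obtain ⟨Q, _, π, T, hT, q, rfl⟩ := h
  exact hT.mem q

/-- One strategy graph serves for all vertices of the winning region. -/
theorem exists_uniform_strategyGraph [Finite V] (E : V → V → Prop) (P : Set V) (W : Set (Set V))
    (U : Set V) :
    ∃ (Q : Type u) (_ : Finite Q) (π : Q → V) (T : Q → Q → Prop),
      IsStrategyGraph E P W U π T ∧ ∀ v, Wins E P W U v → ∃ q, π q = v := by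
  choose Q hQ π T hT q hq using fun v : {v // Wins E P W U v} => v.2
  refine ⟨Σ v, Q v, inferInstance, fun x => π x.1 x.2, SigmaRel T, ⟨?_, ?_, ?_, ?_, ?_⟩, ?_⟩
  · rintro ⟨v, q⟩
    exact (hT v).mem q
  · rintro _ _ ⟨v, q, q', h⟩
    exact (hT v).edge q q' h
  · rintro ⟨v, q⟩ h
    obtain ⟨q', h'⟩ := (hT v).own q h
    exact ⟨_, SigmaRel.mk v q q' h'⟩
  · rintro ⟨v, q⟩ h w hw hE
    obtain ⟨q', h', e⟩ := (hT v).opp q h w hw hE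
    exact ⟨_, SigmaRel.mk v q q' h', e⟩
  · intro x hx
    obtain ⟨v, y, hy, hTy⟩ := SigmaRel.exists_path hx
    have hπ : ∀ n, π (x n).1 (x n).2 = π v (y n) := fun n => by rw [hy n]
    simpa only [hπ] using (hT v).win y hTy
  · intro v hv
    exact ⟨⟨⟨v, hv⟩, q ⟨v, hv⟩⟩, hq ⟨v, hv⟩⟩

/-- A strategy graph that may be left towards the winning region can be completed. -/
theorem wins_of_partial_strategyGraph [Finite V] {Q : Type u} [Finite Q] (π : Q → V)
    (T : Q → Q → Prop) (mem : ∀ q, π q ∈ U) (edge : ∀ q q', T q q' → E (π q) (π q'))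
    (own : ∀ q, π q ∈ P → (∃ q', T q q') ∨ ∃ w, E (π q) w ∧ Wins E P W U w)
    (opp : ∀ q, π q ∉ P → ∀ w ∈ U, E (π q) w → (∃ q', T q q' ∧ π q' = w) ∨ Wins E P W U w)
    (win : ∀ x : ℕ → Q, (∀ n, T (x n) (x (n + 1))) → infSet (fun n => π (x n)) ∈ W) (q : Q) :
    Wins E P W U (π q) := by
  obtain ⟨R, _, ρ, S, hS, hR⟩ := exists_uniform_strategyGraph E P W U
  -- Moves from `Q` into the winning graph `R` are unrestricted and irreversible, so an infinite
  -- path stays in `Q` or has a tail in `R`.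
  let S' : Q ⊕ R → Q ⊕ R → Prop := fun x y =>
    match x, y with
    | .inl q, .inl q' => T q q'
    | .inl q, .inr r => E (π q) (ρ r)
    | .inr _, .inl _ => False
    | .inr r, .inr r' => S r r'
  refine ⟨Q ⊕ R, inferInstance, Sum.elim π ρ, S', ⟨?_, ?_, ?_, ?_, ?_⟩, .inl q, rfl⟩
  · rintro (q | r)
    · exact mem q
    · exact hS.mem r
  · rintro (q | r) (q' | r') h
    · exact edge q q' h
    · exact h
    · exact h.elim
    · exact hS.edge r r' h
  · rintro (q | r) h
    · rcases own q h with ⟨q', h'⟩ | ⟨w, hw, hw'⟩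
      · exact ⟨.inl q', h'⟩
      · obtain ⟨r, rfl⟩ := hR w hw'
        exact ⟨.inr r, hw⟩
    · obtain ⟨r', h'⟩ := hS.own r h
      exact ⟨.inr r', h'⟩
  · rintro (q | r) h w hw hE
    · rcases opp q h w hw hE with ⟨q', h', e⟩ | hw'
      · exact ⟨.inl q', h', e⟩
      · obtain ⟨r, rfl⟩ := hR w hw'
        exact ⟨.inr r, hE, rfl⟩
    · obtain ⟨r', h', e⟩ := hS.opp r h w hw hE
      exact ⟨.inr r', h', e⟩
  · intro x hx
    by_cases hl : ∀ n, ∃ q, x n = .inl q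
    · choose y hy using hl
      simp only [hy, Sum.elim_inl]
      refine win y fun n => ?_
      have := hx n
      rwa [hy, hy] at this
    · push Not at hl
      obtain ⟨N, hN⟩ := hl
      have hr : ∀ n, ∃ r, x (n + N) = .inr r := by
        intro n
        induction n with
        | zero =>
          rcases h : x N with q | r
          · exact absurd h (hN q)
          · exact ⟨r, by simpa using h⟩
        | succ n ih =>
          obtain ⟨r, hr⟩ := ih
          have := hx (n + N)
          rw [hr] at this
          rcases h : x (n + N + 1) with q | r'
          · rw [h] at this
            exact this.elim
          · exact ⟨r', by rw [← h]; congr 1; omega⟩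
      choose y hy using hr
      rw [← infSet_shift _ N]
      simp only [hy, Sum.elim_inr]
      refine hS.win y fun n => ?_
      have := hx (n + N)
      rwa [hy, show n + N + 1 = n + 1 + N by omega, hy] at this

/-- The winning region is closed under forcing in one move. -/
theorem wins_of_forced [Finite V] (hv : v ∈ U) (own : v ∈ P → ∃ w, E v w ∧ Wins E P W U w)
    (opp : v ∉ P → ∀ w ∈ U, E v w → Wins E P W U w) : Wins E P W U v :=
  wins_of_partial_strategyGraph (Q := PUnit) (fun _ => v) (fun _ _ => False) (fun _ => hv)
    (fun _ _ h => h.elim) (fun _ h => .inr (own h)) (fun _ h w hw hE => .inr (opp h w hw hE))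
    (fun _ h => (h 0).elim) ⟨⟩

/-- A winning strategy in a subarena that the opponent cannot leave wins in the larger arena. -/
theorem Wins.of_trap (hU : U' ⊆ U) (h : Wins E P W U' v)
    (trap : ∀ v ∈ U', v ∉ P → ∀ w ∈ U, E v w → w ∈ U') : Wins E P W U v := by
  obtain ⟨Q, hQ, π, T, hT, hv⟩ := h
  exact ⟨Q, hQ, π, T, ⟨fun q => hU (hT.mem q), hT.edge, hT.own,
    fun q hq w hw hE => hT.opp q hq w (trap _ (hT.mem q) hq w hw hE) hE, hT.win⟩, hv⟩

/-- Vertices newly given to the player need a chosen move: the graph already provides for all moves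
there, and `hE` supplies one. -/
theorem Wins.mono (hE : ∀ v ∈ U, ∃ w ∈ U, E v w) (hP : P ⊆ P') (hW : W ⊆ W')
    (h : Wins E P W U v) : Wins E P' W' U v := by
  obtain ⟨Q, hQ, π, T, hT, hv⟩ := h
  refine ⟨Q, hQ, π, T, ⟨hT.mem, hT.edge, fun q _ => ?_, fun q hq => hT.opp q fun h => hq (hP h),
    fun x hx => hW (hT.win x hx)⟩, hv⟩
  by_cases hq : π q ∈ P
  · exact hT.own q hq
  · obtain ⟨w, hw, hE⟩ := hE _ (hT.mem q)
    obtain ⟨q', h', -⟩ := hT.opp q hq w hw hE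
    exact ⟨q', h'⟩

/-- Attractors, with the rank function that measures the distance to the target. -/
theorem exists_attractor [Finite V] (E : V → V → Prop) (P : Set V) {U : Set V} {u : V}
    (hu : u ∈ U) :
    ∃ (X : Set V) (ρ : V → ℕ), X ⊆ U ∧ u ∈ X ∧
      (∀ x ∈ X, x ≠ u → x ∈ P → ∃ w ∈ X, E x w ∧ ρ w < ρ x) ∧
      (∀ x ∈ X, x ≠ u → x ∉ P → ∀ w ∈ U, E x w → w ∈ X ∧ ρ w < ρ x) ∧
      (∀ x ∈ U, x ∉ X → x ∈ P → ∀ w ∈ X, ¬ E x w) ∧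
      (∀ x ∈ U, x ∉ X → x ∉ P → ∃ w ∈ U, w ∉ X ∧ E x w) := by
  classical
  let A : Set (Set V) := {X | ∃ ρ : V → ℕ, X ⊆ U ∧ u ∈ X ∧
      (∀ x ∈ X, x ≠ u → x ∈ P → ∃ w ∈ X, E x w ∧ ρ w < ρ x) ∧
      (∀ x ∈ X, x ≠ u → x ∉ P → ∀ w ∈ U, E x w → w ∈ X ∧ ρ w < ρ x)}
  have hA : A.Nonempty :=
    ⟨{u}, fun _ => 0, by simpa using hu, rfl, fun x hx h => absurd hx h,
      fun x hx h => absurd hx h⟩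
  -- Maximality replaces the usual iteration: a vertex outside `X` from which `X` can be forced in
  -- one move could be added, with a rank above all others.
  obtain ⟨X, hX⟩ := (Set.toFinite A).exists_maximal hA
  obtain ⟨ρ, hXU, huX, h1, h2⟩ := hX.prop
  have key : ∀ x ∈ U, x ∉ X → ¬ ((x ∈ P → ∃ w ∈ X, E x w) ∧
      (x ∉ P → ∀ w ∈ U, E x w → w ∈ X)) := by
    rintro x hxU hxX ⟨k1, k2⟩
    obtain ⟨B, hB⟩ := (Set.finite_range ρ).bddAbove
    have hB' : ∀ w, ρ w < B + 1 := fun w => Nat.lt_succ_of_le (hB ⟨w, rfl⟩)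
    have hup : ∀ w ∈ X, Function.update ρ x (B + 1) w = ρ w := fun w hw =>
      Function.update_of_ne (by rintro rfl; exact hxX hw) _ _
    refine hxX (hX.le_of_ge (y := insert x X) ⟨Function.update ρ x (B + 1),
      Set.insert_subset hxU hXU, Or.inr huX, ?_, ?_⟩ (Set.subset_insert x X)
      (Set.mem_insert x X))
    · rintro y (rfl | hy) hyu hyP
      · obtain ⟨w, hw, hE⟩ := k1 hyP
        exact ⟨w, Or.inr hw, hE, by rw [hup w hw, Function.update_self]; exact hB' w⟩
      · obtain ⟨w, hw, hE, hlt⟩ := h1 y hy hyu hyP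
        exact ⟨w, Or.inr hw, hE, by rwa [hup w hw, hup y hy]⟩
    · rintro y (rfl | hy) hyu hyP w hwU hE
      · have hw := k2 hyP w hwU hE
        exact ⟨Or.inr hw, by rw [hup w hw, Function.update_self]; exact hB' w⟩
      · obtain ⟨hw, hlt⟩ := h2 y hy hyu hyP w hwU hE
        exact ⟨Or.inr hw, by rwa [hup w hw, hup y hy]⟩
  refine ⟨X, ρ, hXU, huX, h1, h2, fun x hxU hxX hxP w hw hE => ?_, fun x hxU hxX hxP => ?_⟩
  · exact key x hxU hxX ⟨fun _ => ⟨w, hw, hE⟩, fun h => absurd hxP h⟩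
  · by_contra! hcon
    refine key x hxU hxX ⟨fun h => absurd h hxP, fun _ w hw hE => ?_⟩
    by_contra hwX
    exact hcon w hw hwX hE

end Wins

/-! ### Determinacy -/

section CyclicGraph

variable {V : Type u} {U : Set V} {Q : U → Type u}

/-- The moves of the strategy that pursues the targets `u ∈ U` in cyclic order: outside of the
attractor `X u` it follows `T u`, and within it decreases the rank `ρ u` until `u` is reached. -/
inductive PursuitRel (E : V → V → Prop) (next : U → U) (π : ∀ u, Q u → V)
    (T : ∀ u, Q u → Q u → Prop) (X : U → Set V) (ρ : U → V → ℕ) :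
    (Σ u, Q u ⊕ X u) → (Σ u, Q u ⊕ X u) → Prop
  | stay (u : U) (q q' : Q u) : T u q q' → PursuitRel E next π T X ρ ⟨u, .inl q⟩ ⟨u, .inl q'⟩
  | enter (u : U) (q : Q u) (x : X u) : E (π u q) x →
      PursuitRel E next π T X ρ ⟨u, .inl q⟩ ⟨u, .inr x⟩
  | approach (u : U) (x x' : X u) : (x : V) ≠ u → E x x' → ρ u x' < ρ u x →
      PursuitRel E next π T X ρ ⟨u, .inr x⟩ ⟨u, .inr x'⟩
  | advance (u : U) (x : X u) (y : Q (next u) ⊕ X (next u)) : (x : V) = u →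
      E u (Sum.elim (π (next u)) Subtype.val y) →
      PursuitRel E next π T X ρ ⟨u, .inr x⟩ ⟨next u, y⟩

variable {E : V → V → Prop} {next : U → U} {π : ∀ u, Q u → V}
  {T : ∀ u, Q u → Q u → Prop} {X : U → Set V} {ρ : U → V → ℕ}

/-- A path of pursuits that reaches only finitely many targets eventually follows some `T u`. -/
theorem PursuitRel.exists_path {x : ℕ → Σ u, Q u ⊕ X u}
    (hx : ∀ n, PursuitRel E next π T X ρ (x n) (x (n + 1))) {N : ℕ}
    (hN : ∀ n ≥ N, ¬ ∃ z : X (x n).1, (x n).2 = .inr z ∧ (z : V) = (x n).1) :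
    ∃ (u : U) (y : ℕ → Q u), (∀ n, x (n + N) = ⟨u, .inl (y n)⟩) ∧
      ∀ n, T u (y n) (y (n + 1)) := by
  have hinl : ∀ n ≥ N, ∃ q, (x n).2 = .inl q := by
    by_contra! hcon
    obtain ⟨n, hn, hq⟩ := hcon
    -- Inside an attractor the rank drops at every move until the target is hit, which cannot happen
    -- after `N`.
    have key : ∀ k, ∃ z : X (x (n + k)).1, (x (n + k)).2 = .inr z ∧
        ρ (x (n + k)).1 z + k ≤ ρ (x n).1 (Sum.elim (π (x n).1) Subtype.val (x n).2) := by
      intro k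
      induction k with
      | zero =>
        rcases h : (x n).2 with q | z
        · exact absurd h (hq q)
        · exact ⟨z, rfl, by simp⟩
      | succ k ih =>
        obtain ⟨z, hz, hle⟩ := ih
        have h1 := hx (n + k)
        have h2 := hN (n + k) (by omega)
        rw [← add_assoc]
        generalize x (n + k) = a at *
        generalize x (n + k + 1) = b at *
        cases h1 with
        | stay u q q' h => cases hz
        | enter u q x h => cases hz
        | approach u z' z'' _ h hlt =>
          cases hz
          exact ⟨z'', rfl, by simp only at hle ⊢; omega⟩
        | advance u z' y h h' => exact absurd ⟨z', rfl, h⟩ h2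
    obtain ⟨z, -, hle⟩ := key (ρ (x n).1 (Sum.elim (π (x n).1) Subtype.val (x n).2) + 1)
    omega
  have hrel : ∀ n, ∀ q, (x (n + N)).2 = .inl q → ∃ q', x (n + 1 + N) = ⟨(x (n + N)).1, .inl q'⟩ ∧
      T (x (n + N)).1 q q' := by
    intro n q hq
    have h1 := hx (n + N)
    have h2 := hinl (n + 1 + N) (by omega)
    rw [show n + N + 1 = n + 1 + N by omega] at h1
    generalize x (n + N) = a at *
    generalize x (n + 1 + N) = b at *
    cases h1 with
    | stay u q q' h =>
      cases hq
      exact ⟨q', rfl, h⟩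
    | enter u q x h => simp at h2
    | approach u z' z'' _ h hlt => cases hq
    | advance u z' y h h' => cases hq
  have hy : ∀ n, ∃ q : Q (x N).1, x (n + N) = ⟨(x N).1, .inl q⟩ := by
    intro n
    induction n with
    | zero =>
      obtain ⟨q, hq⟩ := hinl N le_rfl
      exact ⟨q, by rw [← hq, Nat.zero_add]⟩
    | succ n ih =>
      obtain ⟨q, hq⟩ := ih
      have h := hrel n
      generalize x (n + N) = a at *
      subst hq
      obtain ⟨q', hq', -⟩ := h q rfl
      exact ⟨q', hq'⟩
  choose y hy using hy
  refine ⟨_, y, hy, fun n => ?_⟩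
  have h := hrel n
  have hy0 := hy n
  have hy1 := hy (n + 1)
  generalize x (n + N) = a at *
  subst hy0
  obtain ⟨q', hq', hT⟩ := h (y n) rfl
  rw [hy1] at hq'
  cases hq'
  exact hT

/-- A path of pursuits that reaches infinitely many targets visits all of them again and again. -/
theorem PursuitRel.subset_infSet [Finite V] {x : ℕ → Σ u, Q u ⊕ X u}
    (hnext : ∀ u v, ∃ k, next^[k] u = v)
    (hx : ∀ n, PursuitRel E next π T X ρ (x n) (x (n + 1)))
    (hinf : ∀ N, ∃ n ≥ N, ∃ z : X (x n).1, (x n).2 = .inr z ∧ (z : V) = (x n).1) :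
    U ⊆ infSet (fun n => Sum.elim (π (x n).1) Subtype.val (x n).2) := by
  let D : ℕ → Prop := fun n => ∃ z : X (x n).1, (x n).2 = .inr z ∧ (z : V) = (x n).1
  -- `I u` says that the target `u` is hit infinitely often; it holds for some `u` by pigeonhole.
  let I : U → Prop := fun u => ∀ N, ∃ n ≥ N, D n ∧ (x n).1 = u
  have hI : ∃ u, I u := by
    by_contra! hcon
    simp only [I, not_forall, not_exists, not_and] at hcon
    choose N hN using hcon
    obtain ⟨B, hB⟩ := (Set.finite_range N).bddAbove
    obtain ⟨n, hn, hD⟩ := hinf B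
    exact hN _ n (le_trans (hB ⟨_, rfl⟩) hn) hD rfl
  have hmove : ∀ n, (D n → (x (n + 1)).1 = next (x n).1) ∧ (¬ D n → (x (n + 1)).1 = (x n).1) := by
    intro n
    have h := hx n
    simp only [D]
    generalize x n = a at *
    generalize x (n + 1) = b at *
    cases h with
    | stay u q q' h => simp
    | enter u q z h => simp
    | approach u z z' hz h hlt => simp [hz]
    | advance u z y h h' => simp [h]
  -- The pursued target changes only at hits, so the first hit after one of `u` is one of `next u`.
  have hstep : ∀ u, I u → I (next u) := by
    classical
    intro u hu N
    obtain ⟨n, hn, hD, rfl⟩ := hu N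
    have hm := hinf (n + 1)
    have hlt : ∀ k, n + 1 + k ≤ Nat.find hm → (x (n + 1 + k)).1 = next (x n).1 := by
      intro k
      induction k with
      | zero => exact fun _ => (hmove n).1 hD
      | succ k ih =>
        intro hk
        rw [← ih (by omega)]
        exact (hmove (n + 1 + k)).2 fun h => Nat.find_min hm (by omega) ⟨by omega, h⟩
    obtain ⟨hge, hDm⟩ := Nat.find_spec hm
    refine ⟨Nat.find hm, by omega, hDm, ?_⟩
    rw [← hlt (Nat.find hm - (n + 1)) (by omega)]
    congr 2
    omega
  obtain ⟨u₀, hu₀⟩ := hI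
  intro v hv
  obtain ⟨k, hk⟩ := hnext u₀ ⟨v, hv⟩
  have hIv : I ⟨v, hv⟩ := by
    rw [← hk]
    clear hk
    induction k with
    | zero => exact hu₀
    | succ k ih => rw [Function.iterate_succ_apply']; exact hstep _ ih
  rw [mem_infSet]
  intro N
  obtain ⟨n, hn, ⟨z, hz, hzu⟩, hu⟩ := hIv N
  refine ⟨n, hn, ?_⟩
  simp only [hz, Sum.elim_inr, hzu, hu]

end CyclicGraph

/-- A cyclic permutation of the whole type; it schedules the targets of the pursuit. -/
theorem exists_transitive_map (α : Type*) [Finite α] :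
    ∃ next : α → α, ∀ a b, ∃ k : ℕ, next^[k] a = b := by
  classical
  obtain ⟨f, hf, -⟩ := (Set.to_countable (Set.univ : Set α)).exists_cycleOn
  refine ⟨f, fun a b => ?_⟩
  obtain ⟨k, hk⟩ := hf.exists_pow_eq' Set.finite_univ (Set.mem_univ a) (Set.mem_univ b)
  exact ⟨k, by rw [← hk, Equiv.Perm.iterate_eq_pow]⟩

section Determinacy

variable {V : Type u} [Finite V] {E : V → V → Prop} {P : Set V} {W : Set (Set V)} {U : Set V}

/-- If visiting all vertices is favourable and the opponent wins nowhere, then all vertices are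
won, provided that smaller arenas are determined. -/
theorem wins_of_opponent_wins_nowhere (hE : ∀ v ∈ U, ∃ w ∈ U, E v w) (hW : U ∈ W)
    (ih : ∀ U' ⊂ U, (∀ v ∈ U', ∃ w ∈ U', E v w) →
      ∀ v ∈ U', Wins E P W U' v ∨ Wins E Pᶜ Wᶜ U' v)
    (hopp : ∀ v, ¬ Wins E Pᶜ Wᶜ U v) {v : V} (hv : v ∈ U) : Wins E P W U v := by
  choose X ρ hXU huX hown hopp' htrap hrest using fun u : U => exists_attractor E P u.2
  -- The owner of `P` cannot leave `U \ X u`, so an opponent winning in this smaller arena would win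
  -- in `U`, contrary to `hopp`.
  have hwin : ∀ u : U, ∀ v ∈ U \ X u, Wins E P W (U \ X u) v := by
    intro u v hv
    refine (ih (U \ X u) ⟨Set.sdiff_subset, fun h => (h u.2).2 (huX u)⟩ ?_ v hv).resolve_right ?_
    · rintro x ⟨hxU, hxX⟩
      by_cases hxP : x ∈ P
      · obtain ⟨w, hw, hxw⟩ := hE x hxU
        exact ⟨w, ⟨hw, fun h => htrap u x hxU hxX hxP w h hxw⟩, hxw⟩
      · obtain ⟨w, hw, hwX, hxw⟩ := hrest u x hxU hxX hxP
        exact ⟨w, ⟨hw, hwX⟩, hxw⟩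
    · intro h
      exact hopp v (h.of_trap Set.sdiff_subset fun x hx hxP w hw hxw =>
        ⟨hw, fun h => htrap u x hx.1 hx.2 (not_not.1 hxP) w h hxw⟩)
  choose Q hQ π T hT hcover using
    fun u : U => exists_uniform_strategyGraph E P W (U \ X u)
  obtain ⟨next, hnext⟩ := exists_transitive_map U
  have hlift : ∀ (u : U), ∀ w ∈ U, ∃ y : Q u ⊕ X u, Sum.elim (π u) Subtype.val y = w := by
    intro u w hw
    by_cases hwX : w ∈ X u
    · exact ⟨.inr ⟨w, hwX⟩, rfl⟩
    · obtain ⟨q, hq⟩ := hcover u w (hwin u w ⟨hw, hwX⟩)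
      exact ⟨.inl q, hq⟩
  obtain ⟨y₀, hy₀⟩ := hlift ⟨v, hv⟩ v hv
  have hmem : ∀ z : Σ u, Q u ⊕ X u, Sum.elim (π z.1) Subtype.val z.2 ∈ U := by
    rintro ⟨u, q | z⟩
    · exact ((hT u).mem q).1
    · exact hXU u z.2
  refine ⟨Σ u, Q u ⊕ X u, inferInstance, fun z => Sum.elim (π z.1) Subtype.val z.2,
    PursuitRel E next π T X ρ, ⟨hmem, ?_, ?_, ?_, ?_⟩, ⟨⟨v, hv⟩, y₀⟩, hy₀⟩
  · rintro _ _ (⟨u, q, q', h⟩ | ⟨u, q, z, h⟩ | ⟨u, z, z', -, h, -⟩ | ⟨u, z, y, h, h'⟩)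
    · exact (hT u).edge q q' h
    · exact h
    · exact h
    · simpa only [Sum.elim_inr, h] using h'
  · rintro ⟨u, q | z⟩ hP
    · obtain ⟨q', h⟩ := (hT u).own q hP
      exact ⟨_, .stay u q q' h⟩
    · by_cases hz : (z : V) = u
      · obtain ⟨w, hw, huw⟩ := hE u u.2
        obtain ⟨y, rfl⟩ := hlift (next u) w hw
        exact ⟨_, .advance u z y hz huw⟩
      · obtain ⟨w, hw, hzw, hlt⟩ := hown u z z.2 hz hP
        exact ⟨_, .approach u z ⟨w, hw⟩ hz hzw hlt⟩
  · rintro ⟨u, q | z⟩ hP w hw hqw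
    · by_cases hwX : w ∈ X u
      · exact ⟨_, .enter u q ⟨w, hwX⟩ hqw, rfl⟩
      · obtain ⟨q', h, e⟩ := (hT u).opp q hP w ⟨hw, hwX⟩ hqw
        exact ⟨_, .stay u q q' h, e⟩
    · by_cases hz : (z : V) = u
      · obtain ⟨y, rfl⟩ := hlift (next u) w hw
        exact ⟨⟨next u, y⟩, .advance u z y hz (by simpa only [Sum.elim_inr, hz] using hqw), rfl⟩
      · obtain ⟨hwX, hlt⟩ := hopp' u z z.2 hz hP w hw hqw
        exact ⟨_, .approach u z ⟨w, hwX⟩ hz hqw hlt, rfl⟩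
  · intro x hx
    -- With infinitely many hits the path visits exactly `U ∈ W` infinitely often; otherwise it ends
    -- up in one winning graph `T u`.
    by_cases hinf : ∀ N, ∃ n ≥ N, ∃ z : X (x n).1, (x n).2 = .inr z ∧ (z : V) = (x n).1
    · suffices h : infSet (fun n => Sum.elim (π (x n).1) Subtype.val (x n).2) = U by rwa [h]
      refine Set.Subset.antisymm (fun w hw => ?_) (PursuitRel.subset_infSet hnext hx hinf)
      obtain ⟨n, -, rfl⟩ := mem_infSet.1 hw 0
      exact hmem (x n)
    · push Not at hinf
      obtain ⟨N, hN⟩ := hinf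
      obtain ⟨u, y, hy, hTy⟩ := PursuitRel.exists_path hx (N := N)
        fun n hn ⟨z, hz, hzu⟩ => hN n hn z hz hzu
      rw [← infSet_shift _ N]
      have hπ : ∀ n, Sum.elim (π (x (n + N)).1) Subtype.val (x (n + N)).2 = π u (y n) :=
        fun n => by rw [hy n]; rfl
      simpa only [hπ] using (hT u).win y hTy

/-- Muller games on finite graphs are determined, with finite-memory strategies. -/
theorem wins_or_opponent_wins (n : ℕ) : ∀ (P : Set V) (W : Set (Set V)) (U : Set V),
    U.ncard = n → (∀ v ∈ U, ∃ w ∈ U, E v w) →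
    ∀ v ∈ U, Wins E P W U v ∨ Wins E Pᶜ Wᶜ U v := by
  induction n using Nat.strong_induction_on with
  | _ n ih =>
  have main : ∀ (P : Set V) (W : Set (Set V)) (U : Set V), U ∈ W →
      U.ncard = n → (∀ v ∈ U, ∃ w ∈ U, E v w) →
      ∀ v ∈ U, Wins E P W U v ∨ Wins E Pᶜ Wᶜ U v := by
    intro P W U hW hn hE v hv
    have ih' : ∀ U' ⊂ U, (∀ v ∈ U', ∃ w ∈ U', E v w) →
        ∀ v ∈ U', Wins E P W U' v ∨ Wins E Pᶜ Wᶜ U' v := fun U' hU' =>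
      ih _ (hn ▸ Set.ncard_lt_ncard hU') P W U' rfl
    by_cases hopp : ∀ v, ¬ Wins E Pᶜ Wᶜ U v
    · exact .inl (wins_of_opponent_wins_nowhere hE hW ih' hopp hv)
    push Not at hopp
    obtain ⟨r, hr⟩ := hopp
    by_cases hvR : Wins E Pᶜ Wᶜ U v
    · exact .inr hvR
    -- The opponent can neither enter `R` from outside nor be forced into it, so `U \ R` is a
    -- smaller arena that she cannot leave.
    let R : Set V := {v | Wins E Pᶜ Wᶜ U v}
    have hP : ∀ x ∈ U \ R, x ∉ P → ∀ w ∈ U, E x w → w ∉ R := fun x hx hxP w hw hxw hwR =>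
      hx.2 (wins_of_forced hx.1 (fun _ => ⟨w, hxw, hwR⟩) fun h => absurd hxP h)
    have hnP : ∀ x ∈ U \ R, x ∈ P → ∃ w ∈ U, w ∉ R ∧ E x w := by
      intro x hx hxP
      by_contra! hcon
      refine hx.2 (wins_of_forced hx.1 (fun h => absurd hxP h) fun _ w hw hxw => ?_)
      by_contra hwR
      exact hcon w hw hwR hxw
    have hE' : ∀ x ∈ U \ R, ∃ w ∈ U \ R, E x w := by
      intro x hx
      by_cases hxP : x ∈ P
      · obtain ⟨w, hw, hwR, hxw⟩ := hnP x hx hxP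
        exact ⟨w, ⟨hw, hwR⟩, hxw⟩
      · obtain ⟨w, hw, hxw⟩ := hE x hx.1
        exact ⟨w, ⟨hw, hP x hx hxP w hw hxw⟩, hxw⟩
    rcases ih' (U \ R) ⟨Set.sdiff_subset, fun h => (h hr.mem).2 hr⟩ hE' v ⟨hv, hvR⟩ with h | h
    · exact .inl (h.of_trap Set.sdiff_subset fun x hx hxP w hw hxw => ⟨hw, hP x hx hxP w hw hxw⟩)
    · obtain ⟨Q, _, π, T, hT, q, rfl⟩ := h
      refine .inr (wins_of_partial_strategyGraph π T (fun q => (hT.mem q).1) hT.edge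
        (fun q hq => .inl (hT.own q hq)) (fun q hq w hw hqw => ?_) hT.win q)
      by_cases hwR : w ∈ R
      · exact .inr hwR
      · exact .inl (hT.opp q hq w ⟨hw, hwR⟩ hqw)
  -- Exchanging the two players reduces to `U ∈ W`.
  intro P W U hn hE v hv
  by_cases hW : U ∈ W
  · exact main P W U hW hn hE v hv
  · have := main Pᶜ Wᶜ U hW hn hE v hv
    rw [compl_compl, compl_compl] at this
    exact this.symm

end Determinacy

/-! ### Values -/

theorem wins_univ {V : Type u} [Finite V] {E : V → V → Prop} (hE : ∀ v, ∃ w, E v w) (P : Set V)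
    {W : Set (Set V)} (hW : ∀ S, S ∈ W) (v : V) : Wins E P W Set.univ v :=
  ⟨V, inferInstance, id, E, ⟨fun _ => Set.mem_univ _, fun _ _ h => h, fun v _ => hE v,
    fun _ _ w _ h => ⟨w, h, rfl⟩, fun _ _ => hW _⟩, v, rfl⟩

/-- If every camp `c` wants to maximise a payoff `r c`, then each vertex has a value for each camp:
the opponents of `c` can hold the payoff down to it, and from every vertex there is a path along
which every value is attained. -/
theorem exists_values {V : Type u} [Finite V] {C : Type*} {E : V → V → Prop}
    (hE : ∀ v, ∃ w, E v w) (camp : V → C) (r : C → Set V → ℕ) :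
    ∃ val : C → V → ℕ,
      (∀ c v, Wins E {v | camp v ≠ c} {S | r c S ≤ val c v} Set.univ v) ∧
      ∀ v, ∃ p : ℕ → V, p 0 = v ∧ (∀ n, E (p n) (p (n + 1))) ∧
        ∀ c n, val c (p n) ≤ r c (infSet p) := by
  classical
  have hE' : ∀ v ∈ (Set.univ : Set V), ∃ w ∈ Set.univ, E v w := fun v _ =>
    (hE v).imp fun w hw => ⟨trivial, hw⟩
  choose B hB using fun c => (Set.finite_range (r c)).bddAbove
  replace hB : ∀ c S, r c S ≤ B c := fun c S => hB c ⟨S, rfl⟩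
  let Win : C → ℕ → V → Prop := fun c k v => Wins E {v | camp v = c} {S | k ≤ r c S} Set.univ v
  let val : C → V → ℕ := fun c v => Nat.findGreatest (fun k => Win c k v) (B c)
  have hval : ∀ c v, Win c (val c v) v := fun c v =>
    Nat.findGreatest_spec (P := fun k => Win c k v) (Nat.zero_le _)
      (wins_univ hE _ (fun S => Nat.zero_le _) v)
  have hle : ∀ c v, val c v ≤ B c := fun c v => Nat.findGreatest_le _
  refine ⟨val, fun c v => ?_, fun v => ?_⟩
  · rcases (hle c v).eq_or_lt with h | h
    · exact wins_univ hE _ (fun S => h ▸ hB c S) v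
    · have hnot : ¬ Win c (val c v + 1) v := Nat.findGreatest_is_greatest (Nat.lt_succ_self _) h
      refine ((wins_or_opponent_wins _ _ _ _ rfl hE' v trivial).resolve_left hnot).mono hE'
        (fun _ h => h) fun S hS => ?_
      simp only [Set.mem_compl_iff, Set.mem_ofPred_eq] at hS ⊢
      omega
  · choose Q hQ π T hT hcover using fun (c : C) (k : ℕ) =>
      exists_uniform_strategyGraph E {v | camp v = c} {S | k ≤ r c S} Set.univ
    -- Each camp carries a position in a strategy graph guaranteeing its value at the current
    -- vertex. The camp that owns the vertex chooses the move; the graphs of all others provide for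
    -- it.
    let State := {s : V × (∀ c, Σ k, Q c k) //
      ∀ c, (s.2 c).1 = val c s.1 ∧ π c (s.2 c).1 (s.2 c).2 = s.1}
    have hstep : ∀ s : State, ∃ s' : State, E s.1.1 s'.1.1 ∧
        ∀ c, SigmaRel (T c) (s.1.2 c) (s'.1.2 c) ∨ (s.1.2 c).1 < (s'.1.2 c).1 := by
      rintro ⟨⟨v, x⟩, hs⟩
      simp only at hs
      obtain ⟨q, hq⟩ := (hT _ _).own (x (camp v)).2 (by simp [(hs (camp v)).2])
      set w := π _ _ q with hw
      have hvw : E v w := by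
        have := (hT _ _).edge _ _ hq
        rwa [(hs (camp v)).2] at this
      have hnew : ∀ c, ∃ q' : Q c (x c).1, T c (x c).1 (x c).2 q' ∧ π c (x c).1 q' = w := by
        intro c
        by_cases hc : camp v = c
        · subst hc
          exact ⟨q, hq, rfl⟩
        · exact (hT _ _).opp _ (by simpa [(hs c).2] using hc) w trivial (by rwa [(hs c).2])
      choose q' hTq' hq' using hnew
      -- The old graph still guarantees the old level at `w`.
      have hmono : ∀ c, (x c).1 ≤ val c w := fun c =>
        Nat.le_findGreatest ((hs c).1 ▸ hle c v) ⟨_, hQ _ _, _, _, hT c (x c).1, q' c, hq' c⟩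
      have hy : ∀ c, ∃ y : Σ k, Q c k, (y.1 = val c w ∧ π c y.1 y.2 = w) ∧
          (SigmaRel (T c) (x c) y ∨ (x c).1 < y.1) := by
        intro c
        rcases (hmono c).eq_or_lt with h | h
        · exact ⟨⟨_, q' c⟩, ⟨h, hq' c⟩, .inl (.mk _ (x c).2 (q' c) (hTq' c))⟩
        · obtain ⟨q'', h''⟩ := hcover c (val c w) w (hval c w)
          exact ⟨⟨_, q''⟩, ⟨rfl, h''⟩, .inr h⟩
      choose y hy hy' using hy
      exact ⟨⟨(w, y), hy⟩, hvw, hy'⟩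
    choose next hnextE hnext using hstep
    have hinit : ∀ c, ∃ q, π c (val c v) q = v := fun c => hcover c _ v (hval c v)
    choose q₀ hq₀ using hinit
    let s : ℕ → State := fun n => next^[n] ⟨(v, fun c => ⟨_, q₀ c⟩), fun c => ⟨rfl, hq₀ c⟩⟩
    have hs : ∀ n, s (n + 1) = next (s n) := fun n => Function.iterate_succ_apply' _ _ _
    refine ⟨fun n => (s n).1.1, rfl, fun n => by simp only [hs]; exact hnextE _, fun c n => ?_⟩
    have hkey : ∀ n, SigmaRel (T c) ((s n).1.2 c) ((s (n + 1)).1.2 c) ∨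
        ((s n).1.2 c).1 < ((s (n + 1)).1.2 c).1 := fun n => by rw [hs]; exact hnext _ c
    have hrange : (Set.range fun n => ((s n).1.2 c).1).Finite :=
      (Set.finite_Iic (B c)).subset (by rintro _ ⟨n, rfl⟩; exact ((s n).2 c).1.trans_le (hle c _))
    -- Once the level of `c` is maximal no switch is possible, so from `N` on a single winning graph
    -- is followed.
    obtain ⟨_, ⟨N, rfl⟩, hN⟩ := Set.exists_max_image _ id hrange ⟨_, 0, rfl⟩
    replace hN : ∀ n, ((s n).1.2 c).1 ≤ ((s N).1.2 c).1 := fun n => hN _ ⟨n, rfl⟩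
    have hconst : ∀ n, ((s (n + N)).1.2 c).1 = ((s N).1.2 c).1 ∧
        SigmaRel (T c) ((s (n + N)).1.2 c) ((s (n + N + 1)).1.2 c) := by
      intro n
      have hrel : ∀ m, ((s m).1.2 c).1 = ((s N).1.2 c).1 →
          SigmaRel (T c) ((s m).1.2 c) ((s (m + 1)).1.2 c) := fun m hm =>
        (hkey m).resolve_right (by have := hN (m + 1); omega)
      induction n with
      | zero => rw [Nat.zero_add]; exact ⟨rfl, hrel N rfl⟩
      | succ n ih =>
        have h1 : ((s (n + 1 + N)).1.2 c).1 = ((s N).1.2 c).1 := by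
          rw [← ih.1, show n + 1 + N = n + N + 1 by omega]
          have := ih.2
          generalize (s (n + N)).1.2 c = a at this
          generalize (s (n + N + 1)).1.2 c = b at this
          cases this
          rfl
        exact ⟨h1, hrel _ h1⟩
    obtain ⟨k, y, hy, hTy⟩ := SigmaRel.exists_path (x := fun n => (s (n + N)).1.2 c)
      fun n => by
        have := (hconst n).2
        rwa [show n + N + 1 = n + 1 + N by omega] at this
    have hπ : ∀ n, (s (n + N)).1.1 = π c k (y n) := by
      intro n
      have := ((s (n + N)).2 c).2
      rw [hy n] at this
      exact this.symm
    have hwin := (hT c k).win y hTy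
    simp only [← hπ] at hwin
    rw [infSet_shift (fun n => (s n).1.1) N] at hwin
    have hk : ((s N).1.2 c).1 = k := by
      have := hy 0
      simp only [Nat.zero_add] at this
      rw [this]
    calc val c (s n).1.1 = ((s n).1.2 c).1 := ((s n).2 c).1.symm
      _ ≤ k := hk ▸ hN n
      _ ≤ _ := hwin

/-! ### Finite-state machines -/

section Machine

variable {V A O : Type*} {G : MullerGame V A O} {S : Type*} {s₀ : S} {upd : S → V → S}
  {act : V → S → V}

theorem inducedRun_succ (τ : G.Profile) (n : ℕ) :
    G.inducedRun τ (n + 1) = (τ (G.owner (G.inducedRun τ n))).1 ⟨G.historyAt τ n, rfl⟩ :=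
  History.last_extend _ _ ((τ _).2 ⟨G.historyAt τ n, rfl⟩)

/-- A zero-preserving encoding of a finite type into tuples of bits. -/
theorem exists_bit_encoding (S : Type*) [Finite S] (s₀ : S) :
    ∃ (m : ℕ) (e : S → Fin m → Bool), Function.Injective e ∧ e s₀ = fun _ => false := by
  classical
  obtain ⟨m, ⟨f⟩⟩ := Finite.exists_equiv_fin S
  -- One-hot encoding, translated so that `s₀` becomes zero.
  refine ⟨m, fun s i => xor (decide (f s = i)) (decide (f s₀ = i)), fun s s' h => ?_, ?_⟩
  · have := congrFun h (f s)
    simp only [decide_true] at this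
    by_contra hne
    have hne' : f s' ≠ f s := fun h => hne (f.injective h.symm)
    simp [hne'] at this
  · funext i
    simp

/-- The state of a machine after a history. -/
def stateAfter (s₀ : S) (upd : S → V → S) (h : G.History) : S :=
  h.1.tail.foldl upd s₀

theorem Strategy.isFiniteMemory_of_machine [Finite S] {a : A} (s : G.Strategy a)
    (hs : ∀ h : G.HistoryOf a, s.1 h = act h.1.last (stateAfter s₀ upd h.1)) :
    s.IsFiniteMemory := by
  obtain ⟨m, e, he, he₀⟩ := exists_bit_encoding S s₀
  have : Nonempty S := ⟨s₀⟩
  have hd := Function.leftInverse_invFun he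
  let f : V × (Fin m → Bool) → V × (Fin m → Bool) := fun x =>
    (act x.1 (Function.invFun e x.2), e (upd (Function.invFun e x.2) x.1))
  have hfold : ∀ (l : List V) (s : S),
      l.foldl (fun M v => (f (v, M)).2) (e s) = e (l.foldl upd s) := by
    intro l
    induction l with
    | nil => exact fun s => rfl
    | cons v l ih =>
      intro s
      rw [List.foldl_cons, List.foldl_cons, ← ih]
      simp only [f, hd s]
  refine ⟨m, f, fun h => ?_⟩
  rw [hs h, memory, ← he₀, hfold]
  simp only [f, hd _, stateAfter]

/-- The profile in which all players follow one machine. -/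
def machineProfile (G : MullerGame V A O) (s₀ : S) (upd : S → V → S) (act : V → S → V)
    (hact : ∀ v s, G.E v (act v s)) : G.Profile :=
  fun _ => ⟨fun h => act h.1.last (stateAfter s₀ upd h.1), fun _ => hact _ _⟩

theorem stateAfter_historyAt_succ (τ : G.Profile) (n : ℕ) :
    stateAfter s₀ upd (G.historyAt τ (n + 1)) =
      upd (stateAfter s₀ upd (G.historyAt τ n)) (G.inducedRun τ (n + 1)) := by
  rw [inducedRun_succ, stateAfter, stateAfter]
  change (List.tail ((G.historyAt τ n).1 ++ [_])).foldl _ _ = _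
  rw [List.tail_append_of_ne_nil (History.ne_nil _), List.foldl_append]
  rfl

end Machine

/-! ### Ultimately periodic runs -/

/-- Take `N` beyond all visits to vertices visited only finitely often, and `M` a return to `p N`
after every other vertex has been seen. -/
theorem exists_lasso {V : Type*} [Finite V] (p : ℕ → V) :
    ∃ N M, N < M ∧ p M = p N ∧ ∀ v, v ∈ infSet p ↔ ∃ n, N ≤ n ∧ n < M ∧ p n = v := by
  have h1 : ∀ v, ∃ N, v ∉ infSet p → ∀ n, N ≤ n → p n ≠ v := by
    intro v
    by_cases hv : v ∈ infSet p
    · exact ⟨0, fun h => absurd hv h⟩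
    · rw [mem_infSet] at hv
      push Not at hv
      exact hv.imp fun N hN _ => hN
  choose f hf using h1
  obtain ⟨N, hN⟩ := (Set.finite_range f).bddAbove
  have hinf : ∀ n, N ≤ n → p n ∈ infSet p := fun n hn => by
    by_contra h
    exact hf _ h n (le_trans (hN ⟨_, rfl⟩) hn) rfl
  have h2 : ∀ v, ∃ k, N ≤ k ∧ (v ∈ infSet p → p k = v) := by
    intro v
    by_cases hv : v ∈ infSet p
    · exact (mem_infSet.1 hv N).imp fun k hk => ⟨hk.1, fun _ => hk.2⟩
    · exact ⟨N, le_rfl, fun h => absurd h hv⟩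
  choose k hk hkv using h2
  obtain ⟨B, hB⟩ := (Set.finite_range k).bddAbove
  obtain ⟨M, hM, hpM⟩ := mem_infSet.1 (hinf N le_rfl) (N + B + 1)
  refine ⟨N, M, by omega, hpM, fun v => ⟨fun hv => ⟨k v, hk v, ?_, hkv v hv⟩, ?_⟩⟩
  · have : k v ≤ B := hB ⟨v, rfl⟩
    omega
  · rintro ⟨n, hn, -, rfl⟩
    exact hinf n hn

/-- Every path follows the same edges and visits the same vertices infinitely often as a path that
is driven by a walk through finitely many of its positions. -/
theorem exists_periodic_reindexing {V : Type*} [Finite V] (p : ℕ → V) :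
    ∃ (I : Type) (_ : Finite I) (i₀ : I) (next : I → I) (pos : I → ℕ), pos i₀ = 0 ∧
      (∀ i, p (pos (next i)) = p (pos i + 1)) ∧
      infSet (fun n => p (pos (next^[n] i₀))) = infSet p := by
  obtain ⟨N, M, hNM, hp, hinf⟩ := exists_lasso p
  let next : Fin M → Fin M := fun j => if h : j.1 + 1 < M then ⟨j.1 + 1, h⟩ else ⟨N, hNM⟩
  have hnext : ∀ j : Fin M, j.1 + 1 < M → (next j).1 = j.1 + 1 := fun j h => by simp [next, h]
  have hnext' : ∀ j : Fin M, j.1 + 1 = M → (next j).1 = N := fun j h => by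
    simp [next, show ¬ j.1 + 1 < M by omega]
  let t : ℕ → Fin M := fun n => next^[n] ⟨0, by omega⟩
  have ht : ∀ n, t (n + 1) = next (t n) := fun n => Function.iterate_succ_apply' _ _ _
  have hrun : ∀ n i, (t n).1 + i < M → (t (n + i)).1 = (t n).1 + i := by
    intro n i
    induction i with
    | zero => exact fun _ => rfl
    | succ i ih =>
      intro h
      have := ih (by omega)
      rw [← add_assoc, ht, hnext _ (by omega)]
      omega
  have hwrap : ∀ n, (t (n + (M - (t n).1))).1 = N := by
    intro n
    have h1 := (t n).2
    have h2 := hrun n (M - (t n).1 - 1) (by omega)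
    rw [show n + (M - (t n).1) = n + (M - (t n).1 - 1) + 1 by omega, ht, hnext' _ (by omega)]
  have hge : ∀ n, N ≤ n → N ≤ (t n).1 := by
    intro n hn
    induction n, hn using Nat.le_induction with
    | base =>
      have := hrun 0 N (by simpa [t] using hNM)
      rw [Nat.zero_add] at this
      simp [this]
    | succ n hn ih =>
      rw [ht]
      by_cases h : (t n).1 + 1 < M
      · rw [hnext _ h]
        omega
      · rw [hnext' _ (by have := (t n).2; omega)]
  refine ⟨Fin M, inferInstance, ⟨0, by omega⟩, next, Fin.val, rfl, fun j => ?_, ?_⟩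
  · by_cases h : j.1 + 1 < M
    · rw [hnext j h]
    · have h' : j.1 + 1 = M := by have := j.2; omega
      rw [hnext' j h', h', hp]
  · ext v
    rw [hinf, mem_infSet]
    constructor
    · intro h
      obtain ⟨n, hn, hv⟩ := h N
      exact ⟨(t n).1, hge n hn, (t n).2, hv⟩
    · rintro ⟨j, hj, hjM, rfl⟩ n
      -- Walk until the wrap to `N`, then on to `j`.
      refine ⟨n + (M - (t n).1) + (j - N), by omega, ?_⟩
      change p (t _).1 = _
      rw [hrun _ _ (by rw [hwrap]; omega), hwrap, Nat.add_sub_cancel' hj]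

/-! ### Equilibria from runs -/

/-- A run is the run of a finite-memory Nash equilibrium if, wherever it passes, the opponents of
the owner of the current vertex can enforce a set of outcomes that she does not prefer. -/
theorem exists_finiteMemory_nash {V : Type u} {A O : Type*} [Finite V] (G : MullerGame V A O)
    {p : ℕ → V} (hp : G.IsRun p) (W : A → Set (Set V))
    (hwin : ∀ n, Wins G.E {v | G.owner v ≠ G.owner (p n)} (W (G.owner (p n))) Set.univ (p n))
    (hW : ∀ a q, G.IsRun q → infSet q ∈ W a →
      ¬ G.pref a (G.outcome (infSet p)) (G.outcome (infSet q)))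
    (hirr : ∀ a, ¬ G.pref a (G.outcome (infSet p)) (G.outcome (infSet p))) :
    ∃ σ : G.Profile, G.IsNash σ ∧ G.IsFiniteMemory σ ∧ infSet (G.inducedRun σ) = infSet p := by
  classical
  obtain ⟨I, _, i₀, next, pos, hi₀, hnext, hinf⟩ := exists_periodic_reindexing p
  choose Q hQ π T hT hcover using fun v : V =>
    exists_uniform_strategyGraph G.E {w | G.owner w ≠ G.owner v} (W (G.owner v)) Set.univ
  -- The machine follows the run, and after a deviation at `v` it punishes the owner of `v`.
  let S := I ⊕ Σ v, Q v
  have hEnext : ∀ i, G.E (p (pos i)) (p (pos (next i))) := fun i => by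
    rw [hnext]
    exact hp.2 _
  -- The owner of the vertex left by the wrong edge is the deviator, so vertex and state suffice to
  -- identify her. The remaining inputs do not matter for unilateral deviations.
  have hupd : ∀ (s : S) (w : V), ∃ s' : S,
      (∀ i, s = .inl i → w = p (pos (next i)) → s' = .inl (next i)) ∧
      (∀ i, s = .inl i → w ≠ p (pos (next i)) → G.E (p (pos i)) w →
        ∃ q, π (p (pos i)) q = w ∧ s' = .inr ⟨p (pos i), q⟩) ∧
      (∀ v q, s = .inr ⟨v, q⟩ → (∃ q', T v q q' ∧ π v q' = w) →
        ∃ q', T v q q' ∧ π v q' = w ∧ s' = .inr ⟨v, q'⟩) := by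
    rintro (i | ⟨v, q⟩) w
    · by_cases hw : w = p (pos (next i))
      · refine ⟨.inl (next i), ?_, ?_, by simp⟩
        · rintro _ ⟨⟩ -
          rfl
        · rintro _ ⟨⟩ h
          exact absurd hw h
      · by_cases hE : G.E (p (pos i)) w
        · obtain ⟨q₀, hq₀⟩ := hcover (p (pos i)) (p (pos i)) (hwin (pos i))
          obtain ⟨q, -, hq⟩ := (hT (p (pos i))).opp q₀ (by simp [hq₀]) w trivial
            (by rwa [hq₀])
          refine ⟨.inr ⟨p (pos i), q⟩, ?_, ?_, by simp⟩
          · rintro _ ⟨⟩ h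
            exact absurd h hw
          · rintro _ ⟨⟩ - -
            exact ⟨q, hq, rfl⟩
        · refine ⟨.inl i, ?_, ?_, by simp⟩
          · rintro _ ⟨⟩ h
            exact absurd h hw
          · rintro _ ⟨⟩ - h
            exact absurd h hE
    · by_cases h : ∃ q', T v q q' ∧ π v q' = w
      · obtain ⟨q', h1, h2⟩ := h
        refine ⟨.inr ⟨v, q'⟩, by simp, by simp, ?_⟩
        rintro _ _ ⟨⟩ -
        exact ⟨q', h1, h2, rfl⟩
      · refine ⟨.inr ⟨v, q⟩, by simp, by simp, ?_⟩
        rintro _ _ ⟨⟩ h'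
        exact absurd h' h
  choose upd hupd₁ hupd₂ hupd₃ using hupd
  have hact : ∀ (v : V) (s : S), ∃ w, G.E v w ∧
      (∀ i, s = .inl i → v = p (pos i) → w = p (pos (next i))) ∧
      (∀ u q, s = .inr ⟨u, q⟩ → v = π u q → G.owner v ≠ G.owner u →
        ∃ q', T u q q' ∧ π u q' = w) := by
    rintro v (i | ⟨u, q⟩)
    · by_cases hv : v = p (pos i)
      · refine ⟨p (pos (next i)), hv ▸ hEnext i, ?_, by simp⟩
        rintro _ ⟨⟩ -
        rfl
      · obtain ⟨w, hw⟩ := G.exists_succ v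
        refine ⟨w, hw, ?_, by simp⟩
        rintro _ ⟨⟩ h
        exact absurd h hv
    · by_cases hv : v = π u q ∧ G.owner v ≠ G.owner u
      · obtain ⟨rfl, hu⟩ := hv
        obtain ⟨q', hq'⟩ := (hT u).own q hu
        refine ⟨π u q', (hT u).edge q q' hq', by simp, ?_⟩
        rintro _ _ ⟨⟩ - -
        exact ⟨q', hq', rfl⟩
      · obtain ⟨w, hw⟩ := G.exists_succ v
        refine ⟨w, hw, by simp, ?_⟩
        rintro _ _ ⟨⟩ h1 h2
        exact absurd ⟨h1, h2⟩ hv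
  choose act hactE hact₁ hact₂ using hact
  let t : ℕ → I := fun n => next^[n] i₀
  have ht : ∀ n, t (n + 1) = next (t n) := fun n => Function.iterate_succ_apply' _ _ _
  let σ := G.machineProfile (.inl i₀) upd act hactE
  let x : G.Profile → ℕ → S := fun τ n => stateAfter (.inl i₀) upd (G.historyAt τ n)
  have hx : ∀ τ n, x τ (n + 1) = upd (x τ n) (G.inducedRun τ (n + 1)) := fun τ n =>
    stateAfter_historyAt_succ τ n
  have hstart : ∀ τ, x τ 0 = .inl (t 0) ∧ G.inducedRun τ 0 = p (pos (t 0)) := fun τ =>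
    ⟨rfl, by change G.start = p (pos i₀); rw [hi₀, hp.1]⟩
  have hσ : ∀ n, x σ n = .inl (t n) ∧ G.inducedRun σ n = p (pos (t n)) := by
    intro n
    induction n with
    | zero => exact hstart σ
    | succ n ih =>
      have h : G.inducedRun σ (n + 1) = p (pos (t (n + 1))) := by
        rw [inducedRun_succ, ht]
        exact hact₁ _ _ _ ih.1 ih.2
      exact ⟨by rw [hx, ht]; exact hupd₁ _ _ _ ih.1 (by rw [h, ht]), h⟩
  have hσinf : infSet (G.inducedRun σ) = infSet p := by
    rw [← hinf]
    exact congrArg infSet (funext fun n => (hσ n).2)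
  refine ⟨σ, fun a s => ?_, fun a => ?_, hσinf⟩
  · let τ : G.Profile := Function.update σ a s
    change ¬ G.pref a (G.outcome (infSet (G.inducedRun σ))) (G.outcome (infSet (G.inducedRun τ)))
    rw [hσinf]
    have hfollow : ∀ n, G.owner (G.inducedRun τ n) ≠ a →
        G.inducedRun τ (n + 1) = act (G.inducedRun τ n) (x τ n) := by
      intro n hn
      have hτn : τ (G.owner (G.inducedRun τ n)) = σ (G.owner (G.inducedRun τ n)) :=
        Function.update_of_ne hn _ _
      rw [inducedRun_succ, hτn]
      rfl
    have hEτ := (G.isRun_inducedRun τ).2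
    let OnTrack : ℕ → Prop := fun n => x τ n = .inl (t n) ∧ G.inducedRun τ n = p (pos (t n))
    by_cases htrack : ∀ n, OnTrack n
    · rw [show infSet (G.inducedRun τ) = infSet p by
        rw [← hinf]
        exact congrArg infSet (funext fun n => (htrack n).2)]
      exact hirr a
    · have hdev : ∃ n, OnTrack n ∧ ¬ OnTrack (n + 1) := by
        by_contra! hcon
        exact htrack fun n => Nat.rec (hstart τ) hcon n
      obtain ⟨n, ⟨hxn, hrn⟩, hoff⟩ := hdev
      have hne : G.inducedRun τ (n + 1) ≠ p (pos (next (t n))) := fun h =>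
        hoff ⟨by rw [hx, ht]; exact hupd₁ _ _ _ hxn h, by rw [h, ht]⟩
      -- Everyone but `a` obeys the machine, so the first departure is hers.
      have howner : G.owner (p (pos (t n))) = a := by
        by_contra h
        exact hne ((hfollow n (hrn ▸ h)).trans (hact₁ _ _ _ hxn hrn))
      obtain ⟨q₀, hq₀, hxq₀⟩ := hupd₂ _ _ _ hxn hne (hrn ▸ hEτ n)
      rw [← hx] at hxq₀
      generalize p (pos (t n)) = v at howner q₀ hq₀ hxq₀
      have hpun : ∀ m q, x τ m = .inr ⟨v, q⟩ → π v q = G.inducedRun τ m →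
          ∃ q', T v q q' ∧ π v q' = G.inducedRun τ (m + 1) ∧ x τ (m + 1) = .inr ⟨v, q'⟩ := by
        intro m q hxq hq
        rw [hx]
        refine hupd₃ _ _ _ _ hxq ?_
        by_cases hm : G.owner (G.inducedRun τ m) = a
        · exact (hT v).opp q (by simp [hq, hm, howner]) _ trivial (hq ▸ hEτ m)
        · rw [hfollow m hm]
          exact hact₂ _ _ _ _ hxq hq.symm (howner.symm ▸ hm)
      have hpath : ∀ m, ∃ q, x τ (m + (n + 1)) = .inr ⟨v, q⟩ ∧
          π v q = G.inducedRun τ (m + (n + 1)) := by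
        intro m
        induction m with
        | zero => exact ⟨q₀, by rw [Nat.zero_add]; exact ⟨hxq₀, hq₀⟩⟩
        | succ m ih =>
          obtain ⟨q, h1, h2⟩ := ih
          obtain ⟨q', -, h3, h4⟩ := hpun _ q h1 h2
          exact ⟨q', by rw [show m + 1 + (n + 1) = m + (n + 1) + 1 by omega]; exact ⟨h4, h3⟩⟩
      choose y hy hy' using hpath
      refine hW a _ (G.isRun_inducedRun τ) ?_
      rw [← infSet_shift _ (n + 1), ← howner]
      simp only [← hy']
      refine (hT v).win y fun m => ?_
      obtain ⟨q', h1, -, h2⟩ := hpun _ _ (hy m) (hy' m)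
      have := hy (m + 1)
      rw [show m + 1 + (n + 1) = m + (n + 1) + 1 by omega, h2] at this
      cases this
      exact h1
  · exact Strategy.isFiniteMemory_of_machine (s₀ := (.inl i₀ : S)) (upd := upd) (act := act) _
      fun h => rfl

/-! ### Payoffs -/

/-- The number of predecessors under the transitive closure. -/
noncomputable def rank {α : Type*} (R : α → α → Prop) (x : α) : ℕ :=
  {y | Relation.TransGen R y x}.ncard

/-- The inclusion of predecessor sets is strict because acyclicity keeps `x` out of its own. -/
theorem rank_lt_rank {α : Type*} [Finite α] {R : α → α → Prop}
    (hR : ∀ x, ¬ Relation.TransGen R x x) {x y : α} (h : R x y) : rank R x < rank R y :=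
  Set.ncard_lt_ncard ⟨fun _ hz => Relation.TransGen.tail hz h,
    fun hsub => hR x (hsub (Relation.TransGen.single h))⟩

section Payoff

variable {V : Type u} {A O : Type*} (G : MullerGame V A O)

instance [Finite V] : Finite G.RealizableOutcome := by
  refine Finite.of_injective (fun o : G.RealizableOutcome => infSet o.2.choose) fun x y h => ?_
  have hx := x.2.choose_spec.2
  have hy := y.2.choose_spec.2
  simp only at h
  rw [h, hy] at hx
  exact Subtype.ext hx.symm

/-- The outcome of a run. -/
def runOutcome {p : ℕ → V} (hp : G.IsRun p) : G.RealizableOutcome :=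
  ⟨G.outcome (infSet p), p, hp, rfl⟩

open Classical in
/-- The extension of a payoff function on the realizable outcomes to all sets of vertices. -/
noncomputable def payoff (ρ : G.RealizableOutcome → ℕ) (S : Set V) : ℕ :=
  if h : ∃ p, G.IsRun p ∧ G.outcome (infSet p) = G.outcome S then ρ ⟨G.outcome S, h⟩ else 0

theorem payoff_infSet (ρ : G.RealizableOutcome → ℕ) {p : ℕ → V} (hp : G.IsRun p) :
    G.payoff ρ (infSet p) = ρ (G.runOutcome hp) :=
  dif_pos ⟨p, hp, rfl⟩

variable {G}

/-- If the players are grouped into camps, each with a payoff and values, then a run along which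
all values are attained is the run of an equilibrium, provided that the payoffs reflect
the preferences over its outcome. -/
theorem exists_nash_of_values [Finite V] {C : Type*} (camp : A → C)
    (ρ : C → G.RealizableOutcome → ℕ) (val : C → V → ℕ)
    (hval : ∀ c v, Wins G.E {v | camp (G.owner v) ≠ c} {S | G.payoff (ρ c) S ≤ val c v} Set.univ v)
    {p : ℕ → V} (hp : G.IsRun p) (hle : ∀ c n, val c (p n) ≤ G.payoff (ρ c) (infSet p))
    (hρ : ∀ a q, G.Prefers a (G.runOutcome hp) q →
      ρ (camp a) (G.runOutcome hp) < ρ (camp a) q) :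
    ∃ σ : G.Profile, G.IsNash σ ∧ G.IsFiniteMemory σ ∧
      G.inducedOutcome σ = G.runOutcome hp := by
  obtain ⟨σ, h1, h2, h3⟩ := G.exists_finiteMemory_nash hp
    (fun a => {S | G.payoff (ρ (camp a)) S ≤ G.payoff (ρ (camp a)) (infSet p)})
    (fun n => (hval (camp (G.owner (p n))) (p n)).mono
      (fun v _ => (G.exists_succ v).imp fun w hw => ⟨trivial, hw⟩)
      (by intro v hv h; exact hv (congrArg camp h)) fun S hS => le_trans hS (hle _ n))
    (fun a q hq hS hpref => by
      have := hρ a (G.runOutcome hq) hpref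
      rw [Set.mem_ofPred_eq, payoff_infSet _ _ hp, payoff_infSet _ _ hq] at hS
      omega)
    (fun a h => lt_irrefl _ (hρ a (G.runOutcome hp) h))
  exact ⟨σ, h1, h2, Subtype.ext (congrArg G.outcome h3)⟩

/-- Each player forms her own camp, with `rank` as payoff. -/
theorem exists_finiteMemory_nash_of_acyclic [Finite V] (hG : G.AcyclicPreferences) :
    ∃ σ : G.Profile, G.IsNash σ ∧ G.IsFiniteMemory σ := by
  let ρ : A → G.RealizableOutcome → ℕ := fun a => rank (G.Prefers a)
  obtain ⟨val, hval, hpath⟩ := exists_values G.exists_succ G.owner fun a => G.payoff (ρ a)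
  obtain ⟨p, hp₀, hpE, hle⟩ := hpath G.start
  obtain ⟨σ, h1, h2, -⟩ := exists_nash_of_values id ρ val hval ⟨hp₀, hpE⟩ hle
    fun a q h => rank_lt_rank (hG a) h
  exact ⟨σ, h1, h2⟩

end Payoff

/-! ### Pareto-optimal outcomes -/

section Pareto

variable {V : Type u} {A O : Type*} {G : MullerGame V A O}

theorem LinearPreferences.trans (hG : G.LinearPreferences) {a : A} {x y z : G.RealizableOutcome}
    (h : G.Prefers a x y) (h' : G.Prefers a y z) : G.Prefers a x z :=
  (hG a).toIsStrictOrder.toIsTrans.trans _ _ _ h h'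

theorem LinearPreferences.asymm (hG : G.LinearPreferences) {a : A} {x y : G.RealizableOutcome}
    (h : G.Prefers a x y) : ¬ G.Prefers a y x := fun h' =>
  (hG a).toIsStrictOrder.toIrrefl.irrefl _ (hG.trans h h')

theorem LinearPreferences.total (hG : G.LinearPreferences) (a : A) {x y : G.RealizableOutcome}
    (h : x ≠ y) : G.Prefers a x y ∨ G.Prefers a y x := by
  by_contra! hcon
  exact h ((hG a).toTrichotomous.trichotomous x y hcon.1 hcon.2)

theorem LinearPreferences.acyclic (hG : G.LinearPreferences) : G.AcyclicPreferences := by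
  intro a x h
  have := (hG a).toIsStrictOrder.toIsTrans
  rw [Relation.transGen_eq_self] at h
  exact hG.asymm h h

theorem LinearPreferences.exists_prefers_of_isParetoOptimal (hG : G.LinearPreferences)
    {y q : G.RealizableOutcome} (hy : G.IsParetoOptimal y) (h : q ≠ y) : ∃ b, G.Prefers b q y := by
  by_contra! hcon
  -- The owner of the start shows that there is a player at all.
  exact hy ⟨q, h, ⟨G.owner G.start, (hG.total _ h).resolve_left (hcon _)⟩, hcon⟩

/-- Every outcome that is not Pareto-optimal is dominated by one that is. -/
theorem LinearPreferences.exists_isParetoOptimal [Finite V] (hG : G.LinearPreferences)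
    {x : G.RealizableOutcome} (hx : ¬ G.IsParetoOptimal x) :
    ∃ q, G.IsParetoOptimal q ∧ ∀ b, G.Prefers b x q := by
  have hdom : ∀ x, ¬ G.IsParetoOptimal x → ∃ q, ∀ b, G.Prefers b x q := by
    intro x hx
    obtain ⟨q, hne, -, hq⟩ := not_not.1 hx
    exact ⟨q, fun b => (hG.total b hne).resolve_left (hq b)⟩
  obtain ⟨q, hq, hmax⟩ := Set.exists_max_image {q | ∀ b, G.Prefers b x q}
    (rank (G.Prefers (G.owner G.start))) (Set.toFinite _) (hdom x hx)
  refine ⟨q, ?_, hq⟩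
  by_contra hcon
  obtain ⟨q', hq'⟩ := hdom q hcon
  exact absurd (rank_lt_rank (hG.acyclic _) (hq' (G.owner G.start)))
    (not_lt.2 (hmax q' fun b => hG.trans (hq b) (hq' b)))

/-- All players prefer the Pareto-optimal outcomes over the other ones. -/
theorem LinearPreferences.prefers_isParetoOptimal [Finite V] (hG : G.LinearPreferences)
    (hpat : G.AvoidsPattern) {x y : G.RealizableOutcome} (hx : ¬ G.IsParetoOptimal x)
    (hy : G.IsParetoOptimal y) (a : A) : G.Prefers a x y := by
  obtain ⟨q, hq, hxq⟩ := hG.exists_isParetoOptimal hx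
  by_cases hyq : q = y
  · exact hyq ▸ hxq a
  · have hxy : x ≠ y := by
      rintro rfl
      exact hx hy
    refine (hG.total a hxy).resolve_right fun h => ?_
    obtain ⟨b, hb⟩ := hG.exists_prefers_of_isParetoOptimal hy hyq
    -- Here `x ≺_b q ≺_b y` and `y ≺_a x ≺_a q` are rotations of each other.
    exact hpat b a y q x ⟨⟨hxq b, hb⟩, h, hxq a⟩

/-- On three Pareto-optimal outcomes, the preferences of two players agree or are opposite. -/
theorem LinearPreferences.agree_or_opposite_triple (hG : G.LinearPreferences)
    (hpat : G.AvoidsPattern) {a : A} (b : A) {u v w : G.RealizableOutcome}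
    (hu : G.IsParetoOptimal u) (huv : G.Prefers a u v) (hvw : G.Prefers a v w) :
    (G.Prefers b u v ∧ G.Prefers b v w) ∨ (G.Prefers b w v ∧ G.Prefers b v u) := by
  have huw := hG.trans huv hvw
  have huv' : u ≠ v := by rintro rfl; exact hG.asymm huv huv
  have hvw' : v ≠ w := by rintro rfl; exact hG.asymm hvw hvw
  have huw' : w ≠ u := by rintro rfl; exact hG.asymm huw huw
  -- Optimality of `u` gives a player `c` with `w ≺_c u`, and the pattern forces her to reverse the
  -- order of `a`. The four other orders are rotations of that of `a` or `c`, so `b` has neither.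
  obtain ⟨c, hc⟩ := hG.exists_prefers_of_isParetoOptimal hu huw'
  have hcwv : G.Prefers c w v := (hG.total c hvw').resolve_left fun h =>
    hpat c a u w v ⟨⟨h, hc⟩, huv, hvw⟩
  have hcvu : G.Prefers c v u := (hG.total c huv').resolve_left fun h =>
    hpat a c w v u ⟨⟨huv, hvw⟩, hc, h⟩
  rcases hG.total b huv' with h1 | h1 <;> rcases hG.total b hvw' with h2 | h2
  · exact .inl ⟨h1, h2⟩
  · rcases hG.total b huw' with h3 | h3
    · exact (hpat a b w v u ⟨⟨huv, hvw⟩, h3, h1⟩).elim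
    · exact (hpat c b u v w ⟨⟨hcwv, hcvu⟩, h3, h2⟩).elim
  · rcases hG.total b huw' with h3 | h3
    · exact (hpat b a u w v ⟨⟨h2, h3⟩, huv, hvw⟩).elim
    · exact (hpat b c w u v ⟨⟨h1, h3⟩, hcwv, hcvu⟩).elim
  · exact .inr ⟨h2, h1⟩

/-- The preferences of two players over the Pareto-optimal outcomes agree or are opposite. -/
theorem LinearPreferences.agree_or_opposite (hG : G.LinearPreferences) (hpat : G.AvoidsPattern)
    (a b : A) :
    (∀ x y, G.IsParetoOptimal x → G.IsParetoOptimal y → G.Prefers a x y → G.Prefers b x y) ∨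
    (∀ x y, G.IsParetoOptimal x → G.IsParetoOptimal y → G.Prefers a x y → G.Prefers b y x) := by
  let D : G.RealizableOutcome → G.RealizableOutcome → Prop := fun x y =>
    (G.Prefers a x y ∧ G.Prefers b y x) ∨ (G.Prefers a y x ∧ G.Prefers b x y)
  have hsymm : ∀ x y, D x y → D y x := fun x y h => h.symm
  -- By the triple lemma, disagreement spreads to pairs sharing an outcome, hence to all pairs.
  have hshare : ∀ x y z, G.IsParetoOptimal x → G.IsParetoOptimal y → G.IsParetoOptimal z →
      x ≠ z → D x y → D x z := by
    intro x y z hx hy hz hxz h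
    by_cases hyz : y = z
    · exact hyz ▸ h
    have htriple : ∀ u v w, G.IsParetoOptimal u → G.Prefers a u v → G.Prefers a v w →
      (G.Prefers b u v ∧ G.Prefers b v w) ∨ (G.Prefers b w v ∧ G.Prefers b v u) :=
      fun u v w hu => hG.agree_or_opposite_triple hpat b hu
    have has : ∀ u v, G.Prefers b u v → ¬ G.Prefers b v u := fun u v => hG.asymm
    have htr : ∀ u v w, G.Prefers b u v → G.Prefers b v w → G.Prefers b u w :=
      fun u v w => hG.trans
    have h1 := hG.total a hxz
    have h2 := hG.total a hyz
    simp only [D] at h ⊢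
    grind
  refine or_iff_not_imp_left.2 fun h => ?_
  push Not at h
  obtain ⟨x, y, hx, hy, hxy, hnxy⟩ := h
  have hne : x ≠ y := by rintro rfl; exact hG.asymm hxy hxy
  have hD : D x y := .inl ⟨hxy, (hG.total b hne).resolve_left hnxy⟩
  intro x' y' hx' hy' hxy'
  have hne' : x' ≠ y' := by rintro rfl; exact hG.asymm hxy' hxy'
  have hD' : D x' y' := by
    by_cases h : x = x'
    · exact hshare x' y y' hx' hy hy' hne' (h ▸ hD)
    · exact hshare x' x y' hx' hx hy' hne' (hsymm _ _ (hshare x y x' hx hy hx' h hD))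
  exact hD'.elim And.right fun h => absurd h.1 (hG.asymm hxy')

theorem exists_isParetoOptimal_finiteMemory_nash [Finite V] (hG : G.LinearPreferences)
    (hpat : G.AvoidsPattern) :
    ∃ σ : G.Profile, G.IsNash σ ∧ G.IsFiniteMemory σ ∧
      G.IsParetoOptimal (G.inducedOutcome σ) := by
  classical
  let a₀ := G.owner G.start
  let camp : A → Bool := fun b => decide (∀ x y, G.IsParetoOptimal x → G.IsParetoOptimal y →
    G.Prefers a₀ x y → G.Prefers b x y)
  -- The summand 1 makes a positive payoff of either camp equivalent to Pareto-optimality.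
  let ρ : Bool → G.RealizableOutcome → ℕ := fun c x =>
    if G.IsParetoOptimal x then
      1 + if c then rank (G.Prefers a₀) x else rank (Function.swap (G.Prefers a₀)) x
    else 0
  have hρ : ∀ a o q, G.IsParetoOptimal o → G.Prefers a o q → ρ (camp a) o < ρ (camp a) q := by
    intro a o q ho h
    have hq : G.IsParetoOptimal q := by
      by_contra hq
      exact hG.asymm h (hG.prefers_isParetoOptimal hpat hq ho a)
    have hne : o ≠ q := by rintro rfl; exact hG.asymm h h
    simp only [ρ, ho, hq, if_true]
    by_cases ha : ∀ x y, G.IsParetoOptimal x → G.IsParetoOptimal y →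
        G.Prefers a₀ x y → G.Prefers a x y
    · have hc : camp a = true := decide_eq_true ha
      have := rank_lt_rank (hG.acyclic a₀)
        ((hG.total a₀ hne).resolve_right fun h' => hG.asymm h (ha q o hq ho h'))
      simpa [hc] using this
    · have hc : camp a = false := decide_eq_false ha
      have ha' := (hG.agree_or_opposite hpat a₀ a).resolve_left ha
      have hlt : G.Prefers a₀ q o :=
        (hG.total a₀ hne).resolve_left fun h' => hG.asymm h (ha' o q ho hq h')
      have := rank_lt_rank (R := Function.swap (G.Prefers a₀))
        (fun x hx => hG.acyclic a₀ x (Relation.transGen_swap.1 hx)) hlt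
      simpa [hc] using this
  obtain ⟨val, hval, hpath⟩ := exists_values G.exists_succ (fun v => camp (G.owner v))
    fun c => G.payoff (ρ c)
  obtain ⟨p, hp, hle, hopt⟩ : ∃ p, ∃ hp : G.IsRun p,
      (∀ c n, val c (p n) ≤ G.payoff (ρ c) (infSet p)) ∧
      G.IsParetoOptimal (G.runOutcome hp) := by
    obtain ⟨o, ho⟩ : ∃ o, G.IsParetoOptimal o := by
      obtain ⟨p, hp₀, hpE, -⟩ := hpath G.start
      by_cases h : G.IsParetoOptimal (G.runOutcome ⟨hp₀, hpE⟩)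
      · exact ⟨_, h⟩
      · exact (hG.exists_isParetoOptimal h).imp fun q hq => hq.1
    obtain ⟨_, r, hr, rfl⟩ := o
    by_cases hzero : ∃ n c, val c (r n) ≠ 0
    · obtain ⟨c₀, hc₀⟩ := Nat.find_spec hzero
      have hmin : ∀ m < Nat.find hzero, ∀ c, val c (r m) = 0 := fun m hm => by
        have := Nat.find_min hzero hm
        push Not at this
        exact this
      generalize Nat.find hzero = N at hc₀ hmin
      obtain ⟨q, hq₀, hqE, hle⟩ := hpath (r N)
      -- All values before `N` are 0, so this prefix puts no constraint on the payoffs.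
      let p : ℕ → V := fun n => if n < N then r n else q (n - N)
      have hpr : ∀ n, n ≤ N → p n = r n := by
        intro n hn
        rcases hn.eq_or_lt with rfl | hn
        · simp [p, hq₀]
        · simp [p, hn]
      have hpq : ∀ n, p (n + N) = q n := fun n => by simp [p]
      have hp : G.IsRun p := by
        refine ⟨by rw [hpr 0 (Nat.zero_le _), hr.1], fun n => ?_⟩
        rcases Nat.lt_or_ge n N with hn | hn
        · rw [hpr n hn.le, hpr (n + 1) hn]
          exact hr.2 n
        · obtain ⟨k, rfl⟩ := Nat.exists_eq_add_of_le' hn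
          rw [show k + N + 1 = k + 1 + N by omega, hpq, hpq]
          exact hqE k
      have hinf : infSet p = infSet q := infSet_eq_of_eventually_eq N 0 hpq
      have hle' : ∀ c n, val c (p n) ≤ G.payoff (ρ c) (infSet p) := by
        intro c n
        rcases Nat.lt_or_ge n N with hn | hn
        · rw [hpr n hn.le, hmin n hn]
          exact Nat.zero_le _
        · obtain ⟨k, rfl⟩ := Nat.exists_eq_add_of_le' hn
          rw [hpq, hinf]
          exact hle c k
      refine ⟨p, hp, hle', ?_⟩
      by_contra hopt
      have := hle' c₀ N
      rw [hpr N le_rfl, payoff_infSet _ _ hp] at this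
      simp only [ρ, hopt, if_false] at this
      omega
    · push Not at hzero
      exact ⟨r, hr, fun c n => by rw [hzero]; exact Nat.zero_le _, ho⟩
  obtain ⟨σ, h1, h2, h3⟩ := exists_nash_of_values camp ρ val hval hp hle
    fun a q => hρ a _ q hopt
  exact ⟨σ, h1, h2, h3 ▸ hopt⟩

end Pareto

end MullerGame

theorem theorem41 {V A O : Type*} [Finite V] (G : MullerGame V A O) :
    (G.AcyclicPreferences → ∃ σ : G.Profile, G.IsNash σ ∧ G.IsFiniteMemory σ) ∧
    (G.LinearPreferences → G.AvoidsPattern →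
      ∃ σ : G.Profile, G.IsNash σ ∧ G.IsFiniteMemory σ ∧
        G.IsParetoOptimal (G.inducedOutcome σ)) :=
  ⟨MullerGame.exists_finiteMemory_nash_of_acyclic,
    MullerGame.exists_isParetoOptimal_finiteMemory_nash⟩
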